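/- For a topological space $X$, let $\mathcal V_wX$ be the set of continuous valuations on $X$ (strict, monotone, modular, Scott-continuous maps $\nu\colon\mathcal OX\to[0,\infty]$) with the weak topology, generated by the sets $\{\nu\mid \nu(U)>r\}$ ($U$ open, $r\ge 0$ real). It is a monad on $T_0$ spaces with unit $x\mapsto\delta_x$, action $f\mapsto(\nu\mapsto\nu\circ f^{-1})$ and multiplication $m_X(\varpi)(U)=\int_{\nu}\nu(U)\,d\varpi$ (Choquet integral, $\int h\,d\varpi=\int_0^\infty\varpi(h^{-1}(r,\infty])\,dr$). A $\mathcal V_w$-algebra on a $T_0$ space $X$ is a continuous map $\alpha\colon\mathcal V_wX\to X$ (the structure map) with $\alpha(\delta_x)=x$ for all $x\in X$ and $\alpha\circ m_X=\alpha\circ\mathcal V_w\alpha$; it induces the cone structure $x+y=\alpha(\delta_x+\delta_y)$, $r\cdot x=\alpha(r\delta_x)$ ($r\ge0$). Let $L$ be a complete lattice with its Scott topology and the cone structure $x+y=x\vee y$, $r\cdot x=x$ if $r>0$, $0\cdot x=\bot$. For every continuous valuation $\nu$ on $L$, let $\operatorname{supp}\nu$ be the complement of the largest open set $U$ with $\nu(U)=0$,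 and let $\beta(\nu)=\bigvee\operatorname{supp}\nu$. The following are equivalent: (i) there is a $\mathcal V_w$-algebra on $L$ that induces the cone structure of $L$; (ii) $\beta$ is the structure map of a $\mathcal V_w$-algebra on $L$; (iii) $\beta\colon\mathcal V_wL\to L$ is continuous; (iv) $\vee\colon L\times L\to L$ is jointly continuous (for the product topology on $L \times L$); (v) $L$ is weakly Hausdorff: for all $x,y\in L$ and every open $U\supseteq{\uparrow}x\cap{\uparrow}y$ (upward closures in the specialization order), there are open neighbourhoods $V$ of $x$ and $W$ of $y$ with $V\cap W\subseteq U$. Moreover, (i)–(v) hold if $L$ is core-compact (its lattice of open sets is a continuous lattice), and (i)–(v) imply that $L$ is sober ($T_0$, and every irreducible closed set is the closure of a point). -/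

import Mathlib

open Set TopologicalSpace MeasureTheory
open scoped ENNReal NNReal

namespace ValuationMonad

universe u v

/-- Continuous valuations on a topological space: strict, monotone, modular and Scott-continuous
maps from the lattice of open sets to `[0, ∞]`. -/
@[ext]
structure ContValuation (X : Type u) [TopologicalSpace X] where
  toFun : Opens X → ℝ≥0∞
  strict : toFun ⊥ = 0
  mono : ∀ U V : Opens X, U ≤ V → toFun U ≤ toFun V
  modular : ∀ U V : Opens X, toFun U + toFun V = toFun (U ⊔ V) + toFun (U ⊓ V)
  scott : ∀ D : Set (Opens X), D.Nonempty → DirectedOn (· ≤ ·) D →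
    toFun (sSup D) = ⨆ U ∈ D, toFun U

variable {X : Type u} {Y : Type v} [TopologicalSpace X] [TopologicalSpace Y]

instance : CoeFun (ContValuation X) (fun _ => Opens X → ℝ≥0∞) := ⟨ContValuation.toFun⟩

/-- The weak topology on the set of continuous valuations, with subbasic open sets
`[U > r] = {μ | μ U > r}`. -/
instance : TopologicalSpace (ContValuation X) :=
  generateFrom {S | ∃ (U : Opens X) (r : ℝ≥0), S = {μ : ContValuation X | (r : ℝ≥0∞) < μ U}}

/-- Lower semicontinuous functions from `X` to `[0, ∞]`. -/
abbrev LSC (X : Type u) [TopologicalSpace X] := {h : X → ℝ≥0∞ // LowerSemicontinuous h}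

/-- The open set `h⁻¹ (r, ∞]`. -/
def LSC.above (h : LSC X) (r : ℝ≥0∞) : Opens X :=
  ⟨h.1 ⁻¹' Ioi r, h.2.isOpen_preimage r⟩

/-- The Choquet integral `∫ h dν = ∫₀^∞ ν (h⁻¹ (r, ∞]) dr`. -/
noncomputable def integral (ν : ContValuation X) (h : LSC X) : ℝ≥0∞ :=
  ∫⁻ r in Ioi (0 : ℝ), ν (h.above (ENNReal.ofReal r))

/-! ### Auxiliary facts on the Choquet integral, used to define the monad multiplication -/

theorem tail_le_sum (φ : ℝ → ℝ≥0∞) (hφ : Antitone φ) (ε : ℝ) (hε : 0 < ε) (m : ℕ) :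
    ∫⁻ r in Ioi ((m : ℝ) * ε), φ r ≤ ∑' k : ℕ, ENNReal.ofReal ε * φ ((k + m : ℕ) * ε) := by
  have hsub : Ioi ((m : ℝ) * ε) ⊆
      ⋃ k : ℕ, Ioc (((k + m : ℕ) : ℝ) * ε) (((k + m : ℕ) : ℝ) * ε + ε) := by
    intro r hr
    rw [mem_Ioi] at hr
    have hpos : (m : ℝ) < r / ε := by rw [lt_div_iff₀ hε]; exact hr
    have hc : m < ⌈r / ε⌉₊ := Nat.lt_ceil.2 hpos
    obtain ⟨k, hk⟩ := Nat.exists_eq_add_of_lt hc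
    rw [mem_iUnion]
    refine ⟨k, ?_, ?_⟩
    · have : k + m < ⌈r / ε⌉₊ := by omega
      have := Nat.lt_ceil.1 this
      rwa [lt_div_iff₀ hε] at this
    · have h1 : r / ε ≤ (⌈r / ε⌉₊ : ℝ) := Nat.le_ceil _
      rw [hk, div_le_iff₀ hε] at h1
      push_cast at h1 ⊢
      nlinarith
  calc ∫⁻ r in Ioi ((m : ℝ) * ε), φ r
      ≤ ∫⁻ r in ⋃ k : ℕ, Ioc (((k + m : ℕ) : ℝ) * ε) (((k + m : ℕ) : ℝ) * ε + ε), φ r :=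
        lintegral_mono_set hsub
    _ ≤ ∑' k : ℕ, ∫⁻ r in Ioc (((k + m : ℕ) : ℝ) * ε) (((k + m : ℕ) : ℝ) * ε + ε), φ r :=
        lintegral_iUnion_le _ _
    _ ≤ _ := by
        refine ENNReal.tsum_le_tsum fun k => ?_
        calc _ ≤ ∫⁻ r in Ioc (((k + m : ℕ) : ℝ) * ε) (((k + m : ℕ) : ℝ) * ε + ε),
              φ ((k + m : ℕ) * ε) :=
              setLIntegral_mono' measurableSet_Ioc fun r hr => hφ hr.1.le
          _ = _ := by
              rw [setLIntegral_const, Real.volume_Ioc, mul_comm]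
              simp

theorem sum_le_whole (φ : ℝ → ℝ≥0∞) (hφ : Antitone φ) (ε : ℝ) (hε : 0 < ε) (n : ℕ) :
    ∑ k ∈ Finset.range n, ENNReal.ofReal ε * φ ((k + 1 : ℕ) * ε) ≤ ∫⁻ r in Ioi (0 : ℝ), φ r := by
  have hmono : Monotone fun k : ℕ => (k : ℝ) * ε := fun a b hab => by
    have : (a : ℝ) ≤ b := by exact_mod_cast hab
    exact mul_le_mul_of_nonneg_right this hε.le
  have hdis := hmono.pairwise_disjoint_on_Ioc_succ
  calc ∑ k ∈ Finset.range n, ENNReal.ofReal ε * φ ((k + 1 : ℕ) * ε)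
      ≤ ∑' k : ℕ, ENNReal.ofReal ε * φ ((k + 1 : ℕ) * ε) := ENNReal.sum_le_tsum _
    _ ≤ ∑' k : ℕ, ∫⁻ r in Ioc ((k : ℝ) * ε) (((Order.succ k : ℕ) : ℝ) * ε), φ r := by
        refine ENNReal.tsum_le_tsum fun k => ?_
        calc _ = ∫⁻ r in Ioc ((k : ℝ) * ε) (((Order.succ k : ℕ) : ℝ) * ε),
              φ ((k + 1 : ℕ) * ε) := by
              rw [setLIntegral_const, Real.volume_Ioc, mul_comm]
              congr 2
              simp only [Nat.succ_eq_succ]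
              push_cast
              ring
          _ ≤ _ := setLIntegral_mono' measurableSet_Ioc fun r hr => hφ hr.2
    _ = ∫⁻ r in ⋃ k : ℕ, Ioc ((k : ℝ) * ε) (((Order.succ k : ℕ) : ℝ) * ε), φ r :=
        (lintegral_iUnion (fun _ => measurableSet_Ioc) hdis _).symm
    _ ≤ _ := by
        refine lintegral_mono_set ?_
        intro r hr
        obtain ⟨k, hk⟩ := mem_iUnion.1 hr
        exact lt_of_le_of_lt (by positivity) hk.1

theorem whole_eq_iSup (φ : ℝ → ℝ≥0∞) :
    ∫⁻ r in Ioi (0 : ℝ), φ r = ⨆ N : ℕ, ∫⁻ r in Ioi (2 * (1 / ((N : ℝ) + 1))), φ r := by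
  have hU : Ioi (0 : ℝ) = ⋃ N : ℕ, Ioi (2 * (1 / ((N : ℝ) + 1))) := by
    ext r
    simp only [mem_Ioi, mem_iUnion]
    constructor
    · intro hr
      obtain ⟨N, hN⟩ := exists_nat_one_div_lt (half_pos hr)
      exact ⟨N, by linarith⟩
    · rintro ⟨N, hN⟩
      exact lt_trans (by positivity) hN
  rw [hU]
  refine setLIntegral_iUnion_of_directed _ (Monotone.directed_le ?_)
  intro a b hab
  refine Ioi_subset_Ioi ?_
  have : (a : ℝ) ≤ b := by exact_mod_cast hab
  gcongr

theorem above_anti (h : LSC X) {r s : ℝ≥0∞} (hrs : r ≤ s) : h.above s ≤ h.above r :=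
  fun _ hx => lt_of_le_of_lt hrs hx

theorem level_antitone (ν : ContValuation X) (h : LSC X) :
    Antitone fun r : ℝ => ν (h.above (ENNReal.ofReal r)) :=
  fun _ _ hrs => ν.mono _ _ (above_anti h (ENNReal.ofReal_le_ofReal hrs))

theorem tail_le_of_sums (φ : ℝ → ℝ≥0∞) (hφ : Antitone φ) (N m : ℕ) (hm : m ≤ 2) (c : ℝ≥0∞)
    (hc : ∀ n : ℕ, ∑ k ∈ Finset.range n,
      ENNReal.ofReal (1 / ((N : ℝ) + 1)) * φ ((k + m : ℕ) * (1 / ((N : ℝ) + 1))) ≤ c) :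
    ∫⁻ r in Ioi (2 * (1 / ((N : ℝ) + 1))), φ r ≤ c := by
  have hε : (0 : ℝ) < 1 / ((N : ℝ) + 1) := by positivity
  have hm' : (m : ℝ) ≤ 2 := by exact_mod_cast hm
  refine (lintegral_mono_set (Ioi_subset_Ioi (mul_le_mul_of_nonneg_right hm' hε.le))).trans ?_
  refine (tail_le_sum φ hφ _ hε m).trans ?_
  rw [ENNReal.tsum_eq_iSup_nat]
  exact iSup_le hc

/-- Layers of the sum of two counting functions: `layer U V m k` is the set of points at which
(number of `i ≥ 1` with `x ∈ U i`) + (number of `1 ≤ j ≤ m` with `x ∈ V j`) is at least `k`. -/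
def layer (U V : ℕ → Opens X) : ℕ → ℕ → Opens X
  | 0, k => U k
  | _ + 1, 0 => ⊤
  | m + 1, k + 1 => layer U V m (k + 1) ⊔ (layer U V m k ⊓ V (m + 1))

theorem layer_zero (U V : ℕ → Opens X) (h0 : U 0 = ⊤) : ∀ m, layer U V m 0 = ⊤
  | 0 => h0
  | _ + 1 => rfl

theorem layer_anti (U V : ℕ → Opens X) (hU : Antitone U) (m k : ℕ) :
    layer U V m (k + 1) ≤ layer U V m k := by
  induction m generalizing k with
  | zero => exact hU (Nat.le_succ k)
  | succ m ih =>
    cases k with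
    | zero => exact le_top
    | succ k =>
      exact sup_le_sup (ih _) (inf_le_inf_right _ (ih _))

theorem layer_bot (U V : ℕ → Opens X) (n : ℕ) (hn : ∀ i, n < i → U i = ⊥) (m : ℕ) :
    ∀ k, n + m < k → layer U V m k = ⊥ := by
  induction m with
  | zero => exact hn
  | succ m ih =>
    intro k hk
    cases k with
    | zero => omega
    | succ k => simp [layer, ih (k + 1) (by omega), ih k (by omega)]

theorem layer_step (ν : ContValuation X) (U V : ℕ → Opens X) (h0 : U 0 = ⊤) (hU : Antitone U)
    (m K : ℕ) :
    ∑ k ∈ Finset.range K, ν (layer U V (m + 1) (k + 1)) + ν (layer U V m K ⊓ V (m + 1)) =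
      ∑ k ∈ Finset.range K, ν (layer U V m (k + 1)) + ν (V (m + 1)) := by
  induction K with
  | zero => simp [layer_zero U V h0]
  | succ K ih =>
    have hmod := ν.modular (layer U V m (K + 1)) (layer U V m K ⊓ V (m + 1))
    have hinf : layer U V m (K + 1) ⊓ (layer U V m K ⊓ V (m + 1)) =
        layer U V m (K + 1) ⊓ V (m + 1) := by
      rw [← inf_assoc, inf_eq_left.2 (layer_anti U V hU m K)]
    rw [hinf] at hmod
    rw [Finset.sum_range_succ, Finset.sum_range_succ, add_assoc]
    change _ + (ν (layer U V m (K + 1) ⊔ (layer U V m K ⊓ V (m + 1))) + _) = _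
    rw [← hmod, add_comm (ν (layer U V m (K + 1))), ← add_assoc, ih]
    ring

theorem layer_sum (ν : ContValuation X) (U V : ℕ → Opens X) (h0 : U 0 = ⊤) (hU : Antitone U)
    (n : ℕ) (hn : ∀ i, n < i → U i = ⊥) (m K : ℕ) (hK : n + m ≤ K) :
    ∑ k ∈ Finset.range K, ν (layer U V m (k + 1)) =
      ∑ k ∈ Finset.range n, ν (U (k + 1)) + ∑ k ∈ Finset.range m, ν (V (k + 1)) := by
  induction m generalizing K with
  | zero =>
    simp only [layer, Finset.range_zero, Finset.sum_empty, add_zero]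
    refine (Finset.sum_subset (Finset.range_subset_range.2 (by omega)) fun k _ hk => ?_).symm
    rw [hn (k + 1) (by simp at hk; omega), ν.strict]
  | succ m ih =>
    have h := layer_step ν U V h0 hU m K
    rw [layer_bot U V n hn m K (by omega), bot_inf_eq, ν.strict, add_zero,
      ih K (by omega)] at h
    rw [h, Finset.sum_range_succ _ m, add_assoc]

theorem layer_mem (U V : ℕ → Opens X) (h0 : U 0 = ⊤) (hV0 : V 0 = ⊤) (hV : Antitone V)
    (x : X) (m k : ℕ) (hx : x ∈ layer U V m k) : ∃ i j, i + j = k ∧ x ∈ U i ∧ x ∈ V j ∧ j ≤ m := by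
  induction m generalizing k with
  | zero => exact ⟨k, 0, rfl, hx, by simp [hV0], le_rfl⟩
  | succ m ih =>
    cases k with
    | zero => exact ⟨0, 0, rfl, by simp [h0], by simp [hV0], Nat.zero_le _⟩
    | succ k =>
      rcases hx with hx | hx
      · obtain ⟨i, j, h1, h2, h3, h4⟩ := ih _ hx
        exact ⟨i, j, h1, h2, h3, by omega⟩
      · obtain ⟨i, j, h1, h2, _, h4⟩ := ih _ hx.1
        exact ⟨i, j + 1, by omega, h2, hV (by omega) hx.2, by omega⟩

theorem mem_layer (U V : ℕ → Opens X) (hV : Antitone V) (x : X)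
    (m i j : ℕ) (hj : j ≤ m) (hi : x ∈ U i) (hx : x ∈ V j) : x ∈ layer U V m (i + j) := by
  induction m generalizing j with
  | zero =>
    obtain rfl : j = 0 := by omega
    exact hi
  | succ m ih =>
    rcases Nat.lt_or_ge m j with h | h
    · obtain rfl : j = m + 1 := by omega
      exact Or.inr ⟨ih m le_rfl (hV (by omega) hx), hx⟩
    · have h1 := ih j h hx
      rcases hk : i + j with _ | k
      · trivial
      · rw [hk] at h1
        exact Or.inl h1

/-- The chain `X ⊇ {h > ε} ⊇ {h > 2ε} ⊇ … ⊇ {h > nε} ⊇ ∅ ⊇ …`. -/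
noncomputable def chain (h : LSC X) (ε : ℝ) (n i : ℕ) : Opens X :=
  if i = 0 then ⊤ else if i ≤ n then h.above (ENNReal.ofReal (i * ε)) else ⊥

theorem chain_zero (h : LSC X) (ε : ℝ) (n : ℕ) : chain h ε n 0 = ⊤ := by simp [chain]

theorem chain_succ (h : LSC X) (ε : ℝ) (n k : ℕ) (hk : k < n) :
    chain h ε n (k + 1) = h.above (ENNReal.ofReal ((k + 1 : ℕ) * ε)) := by
  simp only [chain, Nat.add_eq_zero_iff, one_ne_zero, and_false, if_false]
  rw [if_pos (by omega)]

theorem chain_anti (h : LSC X) (ε : ℝ) (hε : 0 < ε) (n : ℕ) : Antitone (chain h ε n) := by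
  intro i j hij
  have : (i : ℝ) ≤ j := by exact_mod_cast hij
  have hle : ENNReal.ofReal (i * ε) ≤ ENNReal.ofReal (j * ε) :=
    ENNReal.ofReal_le_ofReal (mul_le_mul_of_nonneg_right this hε.le)
  unfold chain
  split_ifs
  all_goals first | exact le_top | exact bot_le | exact above_anti h hle | omega

theorem ofReal_nat_add (i j : ℕ) (ε : ℝ) (hε : 0 < ε) :
    ENNReal.ofReal ((i + j : ℕ) * ε) = ENNReal.ofReal (i * ε) + ENNReal.ofReal (j * ε) := by
  rw [← ENNReal.ofReal_add (by positivity) (by positivity)]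
  congr 1
  push_cast
  ring

theorem integral_add (ν : ContValuation X) (f g s : LSC X) (hs : ∀ x, s.1 x = f.1 x + g.1 x) :
    integral ν s = integral ν f + integral ν g := by
  apply le_antisymm
  · unfold integral
    rw [whole_eq_iSup (fun r => ν (s.above (ENNReal.ofReal r)))]
    refine iSup_le fun N => ?_
    have hε : (0 : ℝ) < 1 / ((N : ℝ) + 1) := by positivity
    refine tail_le_of_sums _ (level_antitone ν s) N 2 le_rfl _ fun n => ?_
    set ε : ℝ := 1 / ((N : ℝ) + 1)
    refine le_trans ?_ (add_le_add (sum_le_whole _ (level_antitone ν f) ε hε n)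
      (sum_le_whole _ (level_antitone ν g) ε hε n))
    simp only [← Finset.mul_sum, ← mul_add]
    refine mul_le_mul_right ?_ _
    have hsum := layer_sum ν (chain f ε n) (chain g ε n) (chain_zero f ε n) (chain_anti f ε hε n)
      n (fun i hi => by simp only [chain]; rw [if_neg (by omega), if_neg (by omega)])
      n (n + n) le_rfl
    have e1 : ∀ h : LSC X, ∑ k ∈ Finset.range n, ν (chain h ε n (k + 1)) =
        ∑ k ∈ Finset.range n, ν (h.above (ENNReal.ofReal ((k + 1 : ℕ) * ε))) := fun h =>
      Finset.sum_congr rfl fun k hk => by rw [chain_succ h ε n k (Finset.mem_range.1 hk)]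
    rw [e1, e1] at hsum
    rw [← hsum]
    refine le_trans ?_ (Finset.sum_le_sum_of_subset
      (Finset.range_subset_range.2 (Nat.le_add_left n n)))
    refine Finset.sum_le_sum fun k hk => ν.mono _ _ ?_
    have hk := Finset.mem_range.1 hk
    intro x hx
    have hx : ENNReal.ofReal ((k + 2 : ℕ) * ε) < f.1 x + g.1 x := by
      rw [← hs]; exact hx
    classical
    set i := Nat.findGreatest (fun i => x ∈ chain f ε n i) (k + 1) with hi
    have hile : i ≤ k + 1 := Nat.findGreatest_le _
    have hiU : x ∈ chain f ε n i :=
      Nat.findGreatest_spec (P := fun i => x ∈ chain f ε n i) (Nat.zero_le (k + 1))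
        (by simp [chain_zero])
    obtain ⟨j, hj⟩ := Nat.exists_eq_add_of_le hile
    have hjV : x ∈ chain g ε n j := by
      rcases Nat.eq_zero_or_pos j with rfl | hjp
      · simp [chain_zero]
      · have hnot : ¬ x ∈ chain f ε n (i + 1) :=
          Nat.findGreatest_is_greatest (P := fun i => x ∈ chain f ε n i) (k := i + 1)
            (n := k + 1) (by omega) (by omega)
        rw [chain_succ f ε n i (by omega)] at hnot
        have hf : f.1 x ≤ ENNReal.ofReal ((i + 1 : ℕ) * ε) := not_lt.1 hnot
        obtain ⟨j, rfl⟩ : ∃ j', j = j' + 1 := ⟨j - 1, by omega⟩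
        rw [chain_succ g ε n j (by omega)]
        have hkk : k + 2 = (i + 1) + (j + 1) := by omega
        rw [hkk, ofReal_nat_add _ _ ε hε] at hx
        by_contra hg
        exact absurd hx (not_lt.2 (add_le_add hf (not_lt.1 hg)))
    rw [hj]
    exact mem_layer _ _ (chain_anti g ε hε n) x n i j
      (by omega) hiU hjV
  · unfold integral
    rw [whole_eq_iSup (fun r => ν (f.above (ENNReal.ofReal r))),
      whole_eq_iSup (fun r => ν (g.above (ENNReal.ofReal r)))]
    have hmono : ∀ φ : ℝ → ℝ≥0∞,
        Monotone fun N : ℕ => ∫⁻ r in Ioi (2 * (1 / ((N : ℝ) + 1))), φ r := fun φ a b hab => by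
      refine lintegral_mono_set (Ioi_subset_Ioi ?_)
      have : (a : ℝ) ≤ b := by exact_mod_cast hab
      gcongr
    rw [ENNReal.iSup_add_iSup_of_monotone (hmono _) (hmono _)]
    refine iSup_le fun N => ?_
    have hε : (0 : ℝ) < 1 / ((N : ℝ) + 1) := by positivity
    have key : ∀ n : ℕ,
        ∑ k ∈ Finset.range n, ENNReal.ofReal (1 / ((N : ℝ) + 1)) *
          ν (f.above (ENNReal.ofReal ((k + 1 : ℕ) * (1 / ((N : ℝ) + 1))))) +
        ∑ k ∈ Finset.range n, ENNReal.ofReal (1 / ((N : ℝ) + 1)) *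
          ν (g.above (ENNReal.ofReal ((k + 1 : ℕ) * (1 / ((N : ℝ) + 1))))) ≤
        ∫⁻ r in Ioi (0 : ℝ), ν (s.above (ENNReal.ofReal r)) := by
      intro n
      set ε : ℝ := 1 / ((N : ℝ) + 1)
      refine le_trans ?_ (sum_le_whole _ (level_antitone ν s) ε hε (n + n))
      simp only [← Finset.mul_sum, ← mul_add]
      refine mul_le_mul_right ?_ _
      have hsum := layer_sum ν (chain f ε n) (chain g ε n) (chain_zero f ε n)
        (chain_anti f ε hε n)
        n (fun i hi => by simp only [chain]; rw [if_neg (by omega), if_neg (by omega)])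
        n (n + n) le_rfl
      have e1 : ∀ h : LSC X, ∑ k ∈ Finset.range n, ν (chain h ε n (k + 1)) =
          ∑ k ∈ Finset.range n, ν (h.above (ENNReal.ofReal ((k + 1 : ℕ) * ε))) := fun h =>
        Finset.sum_congr rfl fun k hk => by rw [chain_succ h ε n k (Finset.mem_range.1 hk)]
      rw [e1, e1] at hsum
      rw [← hsum]
      refine Finset.sum_le_sum fun k _ => ν.mono _ _ fun x hx => ?_
      obtain ⟨i, j, hij, hxi, hxj, -⟩ := layer_mem _ _ (chain_zero f ε n) (chain_zero g ε n)
        (chain_anti g ε hε n) x n (k + 1) hx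
      have hgt : ∀ (h : LSC X) (i : ℕ), x ∈ chain h ε n (i + 1) →
          ENNReal.ofReal ((i + 1 : ℕ) * ε) < h.1 x := fun h i hx => by
        by_cases hin : i < n
        · rw [chain_succ h ε n i hin] at hx
          exact hx
        · simp only [chain] at hx
          rw [if_neg (by omega), if_neg (by omega)] at hx
          exact absurd hx (by simp)
      change _ < s.1 x
      rw [hs, ← hij, ofReal_nat_add _ _ ε hε]
      rcases i with _ | i <;> rcases j with _ | j
      · omega
      · simpa using lt_of_lt_of_le (hgt g j hxj) le_add_self
      · simpa using lt_of_lt_of_le (hgt f i hxi) le_self_add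
      · exact ENNReal.add_lt_add (hgt f i hxi) (hgt g j hxj)
    have hmonoS : ∀ h : LSC X, Monotone fun n : ℕ => ∑ k ∈ Finset.range n,
        ENNReal.ofReal (1 / ((N : ℝ) + 1)) *
          ν (h.above (ENNReal.ofReal ((k + 1 : ℕ) * (1 / ((N : ℝ) + 1))))) := fun h a b hab =>
      Finset.sum_le_sum_of_subset (Finset.range_subset_range.2 hab)
    have key' := iSup_le key
    rw [← ENNReal.iSup_add_iSup_of_monotone (hmonoS f) (hmonoS g)] at key'
    refine le_trans (add_le_add ?_ ?_) key'
    · exact tail_le_of_sums _ (level_antitone ν f) N 1 (by norm_num) _ fun n =>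
        le_iSup (fun n : ℕ => ∑ k ∈ Finset.range n, ENNReal.ofReal (1 / ((N : ℝ) + 1)) *
          ν (f.above (ENNReal.ofReal ((k + 1 : ℕ) * (1 / ((N : ℝ) + 1)))))) n
    · exact tail_le_of_sums _ (level_antitone ν g) N 1 (by norm_num) _ fun n =>
        le_iSup (fun n : ℕ => ∑ k ∈ Finset.range n, ENNReal.ofReal (1 / ((N : ℝ) + 1)) *
          ν (g.above (ENNReal.ofReal ((k + 1 : ℕ) * (1 / ((N : ℝ) + 1)))))) n

theorem integral_mono (ν : ContValuation X) (f g : LSC X) (h : ∀ x, f.1 x ≤ g.1 x) :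
    integral ν f ≤ integral ν g :=
  lintegral_mono fun _ => ν.mono _ _ fun x hx => lt_of_lt_of_le hx (h x)

theorem integral_zero (ν : ContValuation X) (f : LSC X) (h : ∀ x, f.1 x = 0) :
    integral ν f = 0 := by
  have : ∀ r, f.above r = ⊥ := fun r => by
    ext x
    simp [LSC.above, h]
  simp [integral, this, ν.strict]

theorem integral_sup {ι : Type*} [Nonempty ι] (ν : ContValuation X) (f : ι → LSC X) (s : LSC X)
    (hdir : Directed (fun a b : LSC X => ∀ x, a.1 x ≤ b.1 x) f)
    (hs : ∀ x, s.1 x = ⨆ i, (f i).1 x) : integral ν s ≤ ⨆ i, integral ν (f i) := by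
  have hlev : ∀ r, ν (s.above r) = ⨆ i, ν ((f i).above r) := by
    intro r
    have h1 : s.above r = sSup (range fun i => (f i).above r) := by
      ext x
      rw [sSup_range, Opens.coe_iSup, mem_iUnion]
      change r < s.1 x ↔ _
      rw [hs, lt_iSup_iff]
      rfl
    rw [h1, ν.scott _ (range_nonempty _), iSup_range]
    rintro _ ⟨i, rfl⟩ _ ⟨j, rfl⟩
    obtain ⟨k, hik, hjk⟩ := hdir i j
    exact ⟨_, ⟨k, rfl⟩, fun x hx => lt_of_lt_of_le hx (hik x),
      fun x hx => lt_of_lt_of_le hx (hjk x)⟩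
  conv_lhs => unfold integral
  rw [whole_eq_iSup (fun r => ν (s.above (ENNReal.ofReal r)))]
  refine iSup_le fun N => ?_
  have hε : (0 : ℝ) < 1 / ((N : ℝ) + 1) := by positivity
  refine tail_le_of_sums _ (level_antitone ν s) N 1 (by norm_num) _ fun n => ?_
  simp only [hlev, ENNReal.mul_iSup]
  rw [ENNReal.finsetSum_iSup]
  · exact iSup_mono fun i => sum_le_whole _ (level_antitone ν (f i)) _ hε n
  · intro i j
    obtain ⟨k, hik, hjk⟩ := hdir i j
    exact ⟨k, fun a => ⟨mul_le_mul_right (ν.mono _ _ fun x hx => lt_of_lt_of_le hx (hik x)) _,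
      mul_le_mul_right (ν.mono _ _ fun x hx => lt_of_lt_of_le hx (hjk x)) _⟩⟩

/-! ### The extended probabilistic powerdomain monad -/

/-- The map `μ ↦ μ U` on the space of continuous valuations. -/
def evalAt (U : Opens X) : LSC (ContValuation X) :=
  ⟨fun μ => μ U, by
    rw [lowerSemicontinuous_iff_isOpen_preimage]
    intro r
    induction r with
    | top => simp
    | coe r => exact isOpen_generateFrom_of_mem ⟨U, r, rfl⟩⟩

open Classical in
/-- The Dirac mass `δ_x`, the unit of the monad. -/
noncomputable def dirac (x : X) : ContValuation X where
  toFun U := if x ∈ U then 1 else 0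
  strict := by simp
  mono U V h := by
    by_cases hU : x ∈ U
    · simp [hU, h hU]
    · simp [hU]
  modular U V := by
    by_cases hU : x ∈ U <;> by_cases hV : x ∈ V <;> simp [← SetLike.mem_coe] at * <;>
      simp [hU, hV]
  scott D _ _ := by
    by_cases h : ∃ U ∈ D, x ∈ U
    · rw [if_pos (by simpa [Opens.mem_sSup] using h)]
      obtain ⟨U, hU, hx⟩ := h
      refine le_antisymm (le_iSup₂_of_le U hU (by simp [hx])) (iSup₂_le fun V _ => ?_)
      split_ifs <;> simp
    · rw [if_neg (by simpa [Opens.mem_sSup] using h)]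
      symm
      simp only [ENNReal.iSup_eq_zero]
      intro U hU
      rw [if_neg fun hx => h ⟨U, hU, hx⟩]

/-- Pointwise addition of continuous valuations. -/
noncomputable instance : Add (ContValuation X) where
  add μ ν :=
    { toFun := fun U => μ U + ν U
      strict := by simp [μ.strict, ν.strict]
      mono := fun U V h => add_le_add (μ.mono U V h) (ν.mono U V h)
      modular := fun U V => by
        rw [add_add_add_comm, μ.modular, ν.modular, add_add_add_comm]
      scott := fun D hne hdir => by
        rw [μ.scott D hne hdir, ν.scott D hne hdir]
        simp only [iSup_subtype']
        refine ENNReal.iSup_add_iSup fun U V => ?_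
        obtain ⟨W, hW, hUW, hVW⟩ := hdir U U.2 V V.2
        exact ⟨⟨W, hW⟩, add_le_add (μ.mono _ _ hUW) (ν.mono _ _ hVW)⟩ }

/-- Pointwise multiplication of continuous valuations by nonnegative reals. -/
noncomputable instance : SMul ℝ≥0 (ContValuation X) where
  smul r μ :=
    { toFun := fun U => (r : ℝ≥0∞) * μ U
      strict := by simp [μ.strict]
      mono := fun U V h => mul_le_mul_right (μ.mono U V h) _
      modular := fun U V => by rw [← mul_add, μ.modular, mul_add]
      scott := fun D hne hdir => by
        rw [μ.scott D hne hdir]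
        simp only [ENNReal.mul_iSup] }

/-- The functorial action on a continuous map: `(map f μ) V = μ (f⁻¹ V)`. -/
def map (f : X → Y) (hf : Continuous f) (μ : ContValuation X) : ContValuation Y where
  toFun V := μ (Opens.comap ⟨f, hf⟩ V)
  strict := μ.strict
  mono U V h := μ.mono _ _ fun _ hx => h hx
  modular U V := μ.modular _ _
  scott D hne hdir := by
    have h1 : Opens.comap ⟨f, hf⟩ (sSup D) = sSup (Opens.comap ⟨f, hf⟩ '' D) := by
      rw [map_sSup]
    rw [h1, μ.scott _ (hne.image _), iSup_image]
    rintro _ ⟨U, hU, rfl⟩ _ ⟨V, hV, rfl⟩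
    obtain ⟨W, hW, hUW, hVW⟩ := hdir U hU V hV
    exact ⟨_, ⟨W, hW, rfl⟩, fun _ hx => hUW hx, fun _ hx => hVW hx⟩

/-- The multiplication of the monad: `(mult ϖ) U = ∫ μ(U) dϖ(μ)`. -/
noncomputable def mult (ϖ : ContValuation (ContValuation X)) : ContValuation X where
  toFun U := integral ϖ (evalAt U)
  strict := integral_zero _ _ fun μ => μ.strict
  mono U V h := integral_mono _ _ _ fun μ => μ.mono U V h
  modular U V := by
    have hs : ∀ U V : Opens X, integral ϖ (⟨fun μ => (evalAt U).1 μ + (evalAt V).1 μ,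
        (evalAt U).2.add (evalAt V).2⟩ : LSC (ContValuation X)) =
        integral ϖ (evalAt U) + integral ϖ (evalAt V) :=
      fun U V => integral_add ϖ _ _ _ fun _ => rfl
    rw [← hs, ← hs]
    congr 2
    funext μ
    exact μ.modular U V
  scott D hne hdir := by
    refine le_antisymm ?_ (iSup₂_le fun U hU => integral_mono _ _ _ fun μ =>
      μ.mono _ _ (le_sSup hU))
    rw [iSup_subtype']
    have : Nonempty D := hne.to_subtype
    refine integral_sup ϖ (fun U : D => evalAt U.1) _ ?_ fun μ => ?_
    · intro U V
      obtain ⟨W, hW, hUW, hVW⟩ := hdir U U.2 V V.2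
      exact ⟨⟨W, hW⟩, fun μ => μ.mono _ _ hUW, fun μ => μ.mono _ _ hVW⟩
    · exact (μ.scott D hne hdir).trans iSup_subtype'

/-- `(X, α)` is an Eilenberg–Moore algebra of the extended probabilistic powerdomain monad on the
category of `T₀` spaces and continuous maps. -/
structure IsAlgebra (α : ContValuation X → X) : Prop where
  t0 : T0Space X
  cont : Continuous α
  unit : ∀ x, α (dirac x) = x
  assoc : ∀ ϖ : ContValuation (ContValuation X), α (mult ϖ) = α (map α cont ϖ)

/-- The cone structure (that is, `ℝ≥0`-module structure) of `C` is the one induced by `α`: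
`x + y = α (δ_x + δ_y)` and `r • x = α (r δ_x)`. -/
def InducesCone [AddCommMonoid X] [Module ℝ≥0 X] (α : ContValuation X → X) : Prop :=
  (∀ x y : X, x + y = α (dirac x + dirac y)) ∧ ∀ (r : ℝ≥0) (x : X), r • x = α (r • dirac x)

/-! ### Complete lattices as cones -/

/-- The additive monoid with `x + y = x ⊔ y` and `0 = ⊥`. -/
@[reducible]
def latticeAddCommMonoid (L : Type u) [CompleteLattice L] : AddCommMonoid L where
  add x y := x ⊔ y
  zero := ⊥
  add_assoc := sup_assoc
  zero_add := bot_sup_eq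
  add_zero := sup_bot_eq
  add_comm := sup_comm
  nsmul := @nsmulRec L ⟨⊥⟩ ⟨fun x y => x ⊔ y⟩

open Classical in
/-- The scalar multiplication `r • x = x` for `r > 0` and `0 • x = ⊥`. -/
@[reducible]
noncomputable def latticeModule (L : Type u) [CompleteLattice L] :
    @Module ℝ≥0 L _ (latticeAddCommMonoid L) :=
  letI := latticeAddCommMonoid L
  { smul := fun r x => if 0 < r then x else ⊥
    one_smul := fun x => if_pos one_pos
    mul_smul := fun r s x => by
      change (if 0 < r * s then x else ⊥) = if 0 < r then (if 0 < s then x else ⊥) else ⊥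
      by_cases hr : 0 < r <;> by_cases hs : 0 < s <;> simp_all [pos_iff_ne_zero]
    smul_zero := fun r => by
      change (if 0 < r then (⊥ : L) else ⊥) = ⊥
      simp
    smul_add := fun r x y => by
      change (if 0 < r then x ⊔ y else ⊥) = (if 0 < r then x else ⊥) ⊔ (if 0 < r then y else ⊥)
      split_ifs <;> simp
    add_smul := fun r s x => by
      change (if 0 < r + s then x else ⊥) = (if 0 < r then x else ⊥) ⊔ (if 0 < s then x else ⊥)
      by_cases hr : 0 < r <;> by_cases hs : 0 < s <;> simp_all [pos_iff_ne_zero]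
    zero_smul := fun x => if_neg (lt_irrefl 0) }

/-- `α` induces the lattice cone structure of `L`. -/
def InducesLatticeCone {L : Type u} [CompleteLattice L] [TopologicalSpace L]
    (α : ContValuation L → L) : Prop :=
  @InducesCone L _ (latticeAddCommMonoid L) (latticeModule L) α

/-- The support of `ν`: the complement of the largest open set of `ν`-measure zero. -/
def supp (ν : ContValuation X) : Set X :=
  ((sSup {U : Opens X | ν U = 0} : Opens X) : Set X)ᶜ

/-- `β ν = ⋁ supp ν`. -/
def supBary {L : Type u} [CompleteLattice L] [TopologicalSpace L] (ν : ContValuation L) : L :=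
  sSup (supp ν)

/-! ### Topological conditions -/

/-- The upward closure of `x` in the specialization ordering
(`x ≤ z` iff every open set containing `x` contains `z`). -/
def upSet (x : X) : Set X := {z | ∀ U : Set X, IsOpen U → x ∈ U → z ∈ U}

/-- Weakly Hausdorff spaces. -/
def WeaklyHausdorff (X : Type u) [TopologicalSpace X] : Prop :=
  ∀ (x y : X) (U : Set X), IsOpen U → upSet x ∩ upSet y ⊆ U →
    ∃ V W : Set X, IsOpen V ∧ x ∈ V ∧ IsOpen W ∧ y ∈ W ∧ V ∩ W ⊆ U

/-- The way-below relation of a complete lattice. -/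
def WayBelow {P : Type u} [CompleteLattice P] (a b : P) : Prop :=
  ∀ D : Set P, D.Nonempty → DirectedOn (· ≤ ·) D → b ≤ sSup D → ∃ d ∈ D, a ≤ d

/-- Core-compact spaces: the lattice of open sets is continuous, that is, every open set is the
supremum of the open sets way below it. -/
def CoreCompact (X : Type u) [TopologicalSpace X] : Prop :=
  ∀ U : Opens X, U = sSup {V : Opens X | WayBelow V U}

/-- Sober spaces: `T₀` spaces whose irreducible closed sets are closures of points. -/
def Sober (X : Type u) [TopologicalSpace X] : Prop := T0Space X ∧ QuasiSober X

end ValuationMonad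

namespace ValuationMonad

universe w

/-! ### Null open sets, supports and the weak topology. -/

section Valuations

variable {X : Type w} [TopologicalSpace X]

/-! Everything about `β = supBary` reduces to null sets: `β ν ≤ z` iff `ν` vanishes on the
complement of `↓z` (`supBary_le_iff`). The unit law and the induced cone follow by evaluating at
such open sets; associativity follows because a Choquet integral vanishes iff its integrand is
positive only on a null open set (`integral_eq_zero_iff`). So `β` is an algebra inducing the cone as
soon as it is continuous.

Continuity of `β` comes from joint continuity of `⊔` (`continuous_supBary`). If `β ν` lies in a
Scott-open `U`, then so does the join of finitely many support points, and, by joint continuity, so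
does any join of points chosen in suitable neighbourhoods `V i` of them. The conditions `0 < μ (V
i)` define a weak neighbourhood of `ν`, and any such `μ` has a support point in each `V i`.
Conversely, an algebra inducing the cone writes `x ⊔ y` as `α (δ_x + δ_y)`, which is jointly
continuous.

Weak Hausdorffness is joint continuity restated, since `↑x ∩ ↑y = ↑(x ⊔ y)`. It makes irreducible
closed sets directed, which gives sobriety. Core-compactness yields it by interpolating the
way-below relation between open sets. -/

theorem ContValuation.apply_eq_zero_mono (ν : ContValuation X) {U V : Opens X} (h : U ≤ V)
    (hV : ν V = 0) : ν U = 0 :=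
  le_antisymm (hV ▸ ν.mono U V h) bot_le

/-- By modularity the null open sets are closed under binary joins, hence directed, so Scott
continuity applies to their union. -/
theorem ContValuation.apply_sSup_null (ν : ContValuation X) :
    ν (sSup {U : Opens X | ν U = 0}) = 0 := by
  rw [ν.scott _ ⟨⊥, ν.strict⟩]
  · simp
  · intro U hU V hV
    refine ⟨U ⊔ V, ?_, le_sup_left, le_sup_right⟩
    have h := ν.modular U V
    rw [show ν U = 0 from hU, show ν V = 0 from hV, add_zero] at h
    exact (add_eq_zero.1 h.symm).1

theorem ContValuation.apply_eq_zero_iff_disjoint_supp (ν : ContValuation X) (U : Opens X) :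
    ν U = 0 ↔ Disjoint (U : Set X) (supp ν) := by
  rw [supp, disjoint_compl_right_iff_subset, SetLike.coe_subset_coe]
  exact ⟨fun h => le_sSup h, fun h => ν.apply_eq_zero_mono h ν.apply_sSup_null⟩

theorem ContValuation.apply_pos_iff (ν : ContValuation X) (U : Opens X) :
    0 < ν U ↔ ∃ x ∈ supp ν, x ∈ U := by
  rw [pos_iff_ne_zero, Ne, ν.apply_eq_zero_iff_disjoint_supp, Set.not_disjoint_iff]
  simp [and_comm]

theorem isOpen_setOf_lt_apply (U : Opens X) (r : ℝ≥0) :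
    IsOpen {μ : ContValuation X | (r : ℝ≥0∞) < μ U} :=
  isOpen_generateFrom_of_mem ⟨U, r, rfl⟩

theorem isOpen_setOf_apply_pos (U : Opens X) : IsOpen {μ : ContValuation X | 0 < μ U} := by
  simpa using isOpen_setOf_lt_apply U 0

theorem integral_eq_zero_iff (ν : ContValuation X) (h : LSC X) :
    integral ν h = 0 ↔ ν (h.above 0) = 0 := by
  constructor
  · intro h0
    have key : ∀ n : ℕ, ν (h.above (ENNReal.ofReal (1 / ((n : ℝ) + 1)))) = 0 := by
      intro n
      have hε : (0 : ℝ) < 1 / ((n : ℝ) + 1) := by positivity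
      -- A Riemann sum with a single term is Markov's inequality `ε * ν {h > ε} ≤ ∫ h dν`.
      have hle := sum_le_whole _ (level_antitone ν h) _ hε 1
      change _ ≤ integral ν h at hle
      rw [h0, nonpos_iff_eq_zero, Finset.sum_range_one, mul_eq_zero, ENNReal.ofReal_eq_zero] at hle
      simpa using hle.resolve_left (not_le.2 hε)
    have hsup : h.above 0 =
        sSup (range fun n : ℕ => h.above (ENNReal.ofReal (1 / ((n : ℝ) + 1)))) := by
      refine le_antisymm (fun x hx => ?_) (sSup_le ?_)
      · obtain ⟨q, -, hq0, hq⟩ := ENNReal.lt_iff_exists_real_btwn.1 (show 0 < h.1 x from hx)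
        obtain ⟨n, hn⟩ := exists_nat_one_div_lt (ENNReal.ofReal_pos.1 hq0)
        rw [Opens.mem_sSup]
        exact ⟨_, ⟨n, rfl⟩, lt_of_le_of_lt (ENNReal.ofReal_le_ofReal hn.le) hq⟩
      · rintro _ ⟨n, rfl⟩
        exact above_anti h bot_le
    rw [hsup, ν.scott _ (range_nonempty _), iSup_range]
    · simp only [key, ENNReal.iSup_zero]
    · refine (Monotone.directed_le fun a b hab => above_anti h ?_).directedOn_range
      refine ENNReal.ofReal_le_ofReal ?_
      have : (a : ℝ) ≤ b := by exact_mod_cast hab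
      gcongr
  · intro h0
    have : ∀ r, ν (h.above r) = 0 := fun r => ν.apply_eq_zero_mono (above_anti h bot_le) h0
    simp [integral, this]

open Classical in
theorem dirac_apply (x : X) (U : Opens X) : dirac x U = if x ∈ U then 1 else 0 := rfl

theorem add_apply (μ ν : ContValuation X) (U : Opens X) : (μ + ν) U = μ U + ν U := rfl

theorem smul_apply (r : ℝ≥0) (μ : ContValuation X) (U : Opens X) :
    (r • μ) U = (r : ℝ≥0∞) * μ U := rfl

/-- Each `z ↦ δ_z U` is lower semicontinuous, and so are sums of such maps. This links an arbitrary
algebra to the join of the lattice. -/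
theorem continuous_dirac_add_dirac :
    Continuous fun p : X × X => dirac p.1 + dirac p.2 := by
  refine continuous_generateFrom_iff.2 ?_
  rintro _ ⟨U, r, rfl⟩
  rw [isOpen_iff_mem_nhds]
  rintro ⟨x, y⟩ (hxy : (r : ℝ≥0∞) < dirac x U + dirac y U)
  have hnhds : ∀ z : X, ∀ᶠ z' in nhds z, dirac z U ≤ dirac z' U := by
    intro z
    by_cases hz : z ∈ U
    · filter_upwards [U.isOpen.mem_nhds hz] with z' hz'
      rw [dirac_apply, dirac_apply, if_pos hz, if_pos (show z' ∈ U from hz')]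
    · simp [dirac_apply, hz]
  rw [nhds_prod_eq]
  filter_upwards [(hnhds x).prod_mk (hnhds y)] with p hp
  exact lt_of_lt_of_le hxy (add_le_add hp.1 hp.2)

end Valuations

/-! ### Weak Hausdorffness, joint continuity of the join, and sobriety. -/

section ScottLattice

variable {L : Type w} [CompleteLattice L] [TopologicalSpace L] [Topology.IsScott L Set.univ]

theorem isUpperSet_of_isOpen {U : Set L} (hU : IsOpen U) : IsUpperSet U :=
  Topology.IsScott.isUpperSet_of_isOpen (D := Set.univ) hU

theorem exists_mem_of_sSup_mem {U : Set L} (hU : IsOpen U) {D : Set L} (hne : D.Nonempty)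
    (hD : DirectedOn (· ≤ ·) D) (h : sSup D ∈ U) : ∃ d ∈ D, d ∈ U :=
  (Topology.IsScott.isOpen_iff_isUpperSet_and_dirSupInaccOn (D := Set.univ)).1 hU |>.2
    (Set.mem_univ D) hne hD (isLUB_sSup D) h

theorem isOpen_of_isUpperSet_of_sSup {U : Set L} (hU : IsUpperSet U)
    (h : ∀ D : Set L, D.Nonempty → DirectedOn (· ≤ ·) D → sSup D ∈ U → ∃ d ∈ D, d ∈ U) :
    IsOpen U := by
  refine (Topology.IsScott.isOpen_iff_isUpperSet_and_dirSupInaccOn (D := Set.univ)).2 ⟨hU, ?_⟩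
  intro D _ hne hD a ha haU
  exact h D hne hD (ha.sSup_eq.symm ▸ haU)

theorem upSet_eq_Ici (x : L) : upSet x = Ici x := by
  ext z
  refine ⟨fun h => ?_, fun h U hU hx => isUpperSet_of_isOpen hU h hx⟩
  by_contra hxz
  exact h (Iic z)ᶜ isClosed_Iic.isOpen_compl hxz le_rfl

theorem upSet_inter_upSet_subset_iff {x y : L} {U : Set L} (hU : IsOpen U) :
    upSet x ∩ upSet y ⊆ U ↔ x ⊔ y ∈ U := by
  rw [upSet_eq_Ici, upSet_eq_Ici, Ici_inter_Ici]
  exact ⟨fun h => h self_mem_Ici, fun h _ hz => isUpperSet_of_isOpen hU hz h⟩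

theorem continuous_sup_iff_weaklyHausdorff :
    Continuous (fun p : L × L => p.1 ⊔ p.2) ↔ WeaklyHausdorff L := by
  constructor
  · intro hc x y U hU h
    rw [upSet_inter_upSet_subset_iff hU] at h
    obtain ⟨V, W, hV, hW, hx, hy, hVW⟩ := isOpen_prod_iff.1 (hU.preimage hc) x y h
    refine ⟨V, W, hV, hx, hW, hy, fun z hz => ?_⟩
    -- The diagonal point `(z, z)` lies in the box, and `z ⊔ z = z`.
    simpa using hVW (mk_mem_prod hz.1 hz.2)
  · refine fun hw => continuous_def.2 fun U hU => isOpen_prod_iff.2 fun x y h => ?_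
    obtain ⟨V, W, hV, hx, hW, hy, hVW⟩ := hw x y U hU ((upSet_inter_upSet_subset_iff hU).2 h)
    -- Scott-open sets are upper sets, so `p.1 ⊔ p.2` lies in both `V` and `W`.
    exact ⟨V, W, hV, hW, hx, hy, fun p hp => hVW
      ⟨isUpperSet_of_isOpen hV le_sup_left hp.1, isUpperSet_of_isOpen hW le_sup_right hp.2⟩⟩

theorem WeaklyHausdorff.sober (hw : WeaklyHausdorff L) : Sober L := by
  refine ⟨inferInstance, ⟨fun {C} hC hcl => ⟨sSup C, ?_⟩⟩⟩
  have hdir : DirectedOn (· ≤ ·) C := by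
    intro x hx y hy
    refine ⟨x ⊔ y, ?_, le_sup_left, le_sup_right⟩
    -- Otherwise weak Hausdorffness gives neighbourhoods of `x` and `y` whose intersection misses
    -- `C`, against irreducibility.
    by_contra hxy
    obtain ⟨V, W, hV, hxV, hW, hyW, hVW⟩ := hw x y Cᶜ hcl.isOpen_compl
      ((upSet_inter_upSet_subset_iff hcl.isOpen_compl).2 hxy)
    obtain ⟨z, hzC, hz⟩ := hC.2 V W hV hW ⟨x, hx, hxV⟩ ⟨y, hy, hyW⟩
    exact hVW hz hzC
  have hmem : sSup C ∈ C := by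
    by_contra h
    obtain ⟨d, hd, hd'⟩ := exists_mem_of_sSup_mem hcl.isOpen_compl hC.nonempty hdir h
    exact hd' hd
  rw [IsGenericPoint, Topology.IsScott.closure_singleton]
  exact Subset.antisymm
    (fun z hz => Topology.IsScott.isLowerSet_of_isClosed hcl hz hmem) fun z hz => le_sSup hz

end ScottLattice

/-! ### The way-below relation, and joins of directed sets. -/

section CompleteLattice

variable {P : Type w} [CompleteLattice P]

theorem WayBelow.le {a b : P} (h : WayBelow a b) : a ≤ b := by
  obtain ⟨d, hd, had⟩ := h {b} (singleton_nonempty b) (directedOn_singleton _) (by simp)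
  exact had.trans hd.le

theorem WayBelow.mono {a a' b b' : P} (h : WayBelow a b) (ha : a' ≤ a) (hb : b ≤ b') :
    WayBelow a' b' := fun D hne hD hbD => by
  obtain ⟨d, hd, had⟩ := h D hne hD (hb.trans hbD)
  exact ⟨d, hd, ha.trans had⟩

theorem WayBelow.sup {a a' b : P} (h : WayBelow a b) (h' : WayBelow a' b) :
    WayBelow (a ⊔ a') b := fun D hne hD hbD => by
  obtain ⟨d, hd, had⟩ := h D hne hD hbD
  obtain ⟨d', hd', had'⟩ := h' D hne hD hbD
  obtain ⟨e, he, hde, hde'⟩ := hD d hd d' hd'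
  exact ⟨e, he, sup_le (had.trans hde) (had'.trans hde')⟩

theorem wayBelow_bot (b : P) : WayBelow ⊥ b := fun _ hne _ _ =>
  let ⟨d, hd⟩ := hne; ⟨d, hd, bot_le⟩

/-- Interpolation: the elements two way-below steps under `c` form a directed set, and using
continuity twice shows that its supremum is at least `c`. -/
theorem WayBelow.exists_between (hP : ∀ b : P, b = sSup {a | WayBelow a b}) {a c : P}
    (h : WayBelow a c) : ∃ b, WayBelow a b ∧ WayBelow b c := by
  obtain ⟨d, ⟨b, hdb, hbc⟩, had⟩ := h {d | ∃ b, WayBelow d b ∧ WayBelow b c}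
    ⟨⊥, ⊥, wayBelow_bot _, wayBelow_bot _⟩
    (by
      rintro d ⟨b, hdb, hbc⟩ d' ⟨b', hdb', hbc'⟩
      exact ⟨d ⊔ d', ⟨b ⊔ b', (hdb.mono le_rfl le_sup_left).sup (hdb'.mono le_rfl le_sup_right),
        hbc.sup hbc'⟩, le_sup_left, le_sup_right⟩)
    (by
      conv_lhs => rw [hP c]
      refine sSup_le fun b hb => ?_
      rw [hP b]
      exact sSup_le fun d hd => le_sSup ⟨b, hd, hb⟩)
  exact ⟨b, hdb.mono had le_rfl, hbc⟩

theorem sSup_sup_eq_sSup_image {D : Set P} (hne : D.Nonempty) (y : P) :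
    sSup D ⊔ y = sSup ((· ⊔ y) '' D) := by
  rw [sSup_image, sSup_eq_iSup, biSup_sup hne]

theorem directedOn_image_sup {D : Set P} (hD : DirectedOn (· ≤ ·) D) (y : P) :
    DirectedOn (· ≤ ·) ((· ⊔ y) '' D) := by
  rintro _ ⟨a, ha, rfl⟩ _ ⟨b, hb, rfl⟩
  obtain ⟨c, hc, hac, hbc⟩ := hD a ha b hb
  exact ⟨_, ⟨c, hc, rfl⟩, sup_le_sup_right hac y, sup_le_sup_right hbc y⟩

theorem continuous_sup_of_inducesLatticeCone [TopologicalSpace P] {α : ContValuation P → P}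
    (hα : Continuous α)
    (h : InducesLatticeCone α) : Continuous fun p : P × P => p.1 ⊔ p.2 := by
  have : (fun p : P × P => p.1 ⊔ p.2) = fun p => α (dirac p.1 + dirac p.2) :=
    funext fun p => h.1 p.1 p.2
  rw [this]
  exact hα.comp continuous_dirac_add_dirac

end CompleteLattice

/-! ### Separate continuity of the join, and the core-compact case. -/

section ScottLattice

variable {L : Type w} [CompleteLattice L] [TopologicalSpace L] [Topology.IsScott L Set.univ]

/-- The join preserves directed suprema in each variable, so it is always separately continuous;
only joint continuity is at stake. -/
theorem exists_sup_mem_of_sSup_sup_mem {U : Set L} (hU : IsOpen U) {D : Set L}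
    (hne : D.Nonempty) (hD : DirectedOn (· ≤ ·) D) {y : L} (h : sSup D ⊔ y ∈ U) :
    ∃ d ∈ D, d ⊔ y ∈ U := by
  rw [sSup_sup_eq_sSup_image hne] at h
  obtain ⟨_, ⟨d, hd, rfl⟩, hdU⟩ :=
    exists_mem_of_sSup_mem hU (hne.image _) (directedOn_image_sup hD y) h
  exact ⟨d, hd, hdU⟩

/-- The open set of all `y` with `x ⊔ y ∈ U`. -/
def supPreimage (U : Opens L) (x : L) : Opens L :=
  ⟨{y | x ⊔ y ∈ U}, isOpen_of_isUpperSet_of_sSup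
    (fun _ _ h hy => isUpperSet_of_isOpen U.isOpen (sup_le_sup_left h x) hy)
    fun D hne hD h => by
      simp only [mem_ofPred_eq, sup_comm x] at h ⊢
      exact exists_sup_mem_of_sSup_sup_mem U.isOpen hne hD h⟩

theorem supPreimage_mono (U : Opens L) : Monotone (supPreimage U) :=
  fun _ _ h y hy => isUpperSet_of_isOpen U.isOpen (sup_le_sup_right h y) hy

/-- Together with monotonicity, this says that `x ↦ supPreimage U x` is Scott-continuous into the
lattice of open sets. -/
theorem supPreimage_sSup (U : Opens L) {D : Set L} (hne : D.Nonempty)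
    (hD : DirectedOn (· ≤ ·) D) :
    supPreimage U (sSup D) ≤ sSup (supPreimage U '' D) := by
  intro y hy
  obtain ⟨d, hd, hdU⟩ := exists_sup_mem_of_sSup_sup_mem U.isOpen hne hD hy
  exact Opens.mem_sSup.2 ⟨_, ⟨d, hd, rfl⟩, hdU⟩

theorem CoreCompact.weaklyHausdorff (hc : CoreCompact L) : WeaklyHausdorff L := by
  intro x y U hU h
  rw [upSet_inter_upSet_subset_iff hU] at h
  lift U to Opens L using hU
  have hy : y ∈ supPreimage U x := h
  rw [hc (supPreimage U x), Opens.mem_sSup] at hy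
  obtain ⟨W, hW, hyW⟩ := hy
  -- If `z` lies in both sets, then `z ∈ W ≤ supPreimage U z`, that is, `z ⊔ z ∈ U`.
  refine ⟨{x' | WayBelow W (supPreimage U x')}, W, ?_, hW, W.isOpen, hyW, ?_⟩
  · refine isOpen_of_isUpperSet_of_sSup
      (fun _ _ h hx => WayBelow.mono hx le_rfl (supPreimage_mono U h)) fun D hne hD hDW => ?_
    -- Without the intermediate `W'` one would only get `W ≤ supPreimage U d`, not way-below.
    obtain ⟨W', hWW', hW'⟩ := WayBelow.exists_between hc hDW
    obtain ⟨_, ⟨d, hd, rfl⟩, hle⟩ := hW' (supPreimage U '' D) (hne.image _)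
      (by
        rintro _ ⟨a, ha, rfl⟩ _ ⟨b, hb, rfl⟩
        obtain ⟨c, hc, hac, hbc⟩ := hD a ha b hb
        exact ⟨_, ⟨c, hc, rfl⟩, supPreimage_mono U hac, supPreimage_mono U hbc⟩)
      (supPreimage_sSup U hne hD)
    exact ⟨d, hd, hWW'.mono le_rfl hle⟩
  · rintro z ⟨hz, hzW⟩
    have : z ⊔ z ∈ U := WayBelow.le hz hzW
    rwa [sup_idem] at this

/-! ### The barycenter map `supBary` -/

/-- `↓z` is closed, and it contains the support exactly when its complement is null. Since an
element is determined by its upper bounds, this characterizes `supBary`. -/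
theorem supBary_le_iff (ν : ContValuation L) (z : L) :
    supBary ν ≤ z ↔ ν ⟨(Iic z)ᶜ, isClosed_Iic.isOpen_compl⟩ = 0 := by
  rw [ν.apply_eq_zero_iff_disjoint_supp, supBary, sSup_le_iff]
  exact disjoint_compl_left_iff_subset.symm

theorem supBary_dirac (x : L) : supBary (dirac x) = x :=
  eq_of_forall_ge_iff fun z => by
    rw [supBary_le_iff, dirac_apply]
    simp [← SetLike.mem_coe]

theorem supBary_dirac_add_dirac (x y : L) : supBary (dirac x + dirac y) = x ⊔ y :=
  eq_of_forall_ge_iff fun z => by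
    rw [supBary_le_iff, add_apply, dirac_apply, dirac_apply, sup_le_iff, add_eq_zero]
    simp [← SetLike.mem_coe]

open Classical in
theorem supBary_smul_dirac (r : ℝ≥0) (x : L) :
    supBary (r • dirac x) = if 0 < r then x else ⊥ :=
  eq_of_forall_ge_iff fun z => by
    rw [supBary_le_iff, smul_apply, dirac_apply]
    split_ifs <;> simp_all [← SetLike.mem_coe, pos_iff_ne_zero]

theorem inducesLatticeCone_supBary : InducesLatticeCone (supBary (L := L)) :=
  ⟨fun x y => (supBary_dirac_add_dirac x y).symm, fun r x => (supBary_smul_dirac r x).symm⟩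

theorem isAlgebra_supBary (hc : Continuous (supBary (L := L))) :
    IsAlgebra (supBary (L := L)) where
  t0 := inferInstance
  cont := hc
  unit := supBary_dirac
  assoc ϖ := eq_of_forall_ge_iff fun z => by
    rw [supBary_le_iff, supBary_le_iff]
    change integral ϖ (evalAt _) = 0 ↔ ϖ (Opens.comap ⟨supBary, hc⟩ _) = 0
    rw [integral_eq_zero_iff]
    -- Both sides measure the same open set of valuations: those that charge the complement of `↓z`.
    suffices h : ∀ V W : Opens (ContValuation L), V = W → (ϖ V = 0 ↔ ϖ W = 0) by
      refine h _ _ (Opens.ext (Set.ext fun ν => ?_))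
      change 0 < ν _ ↔ ¬ supBary ν ≤ z
      rw [supBary_le_iff, pos_iff_ne_zero]
    rintro V _ rfl
    rfl

/-- Any supremum is the directed supremum of the joins of finite subsets, the empty one included. -/
theorem exists_finset_sup_mem {U : Set L} (hU : IsOpen U) {S : Set L} (h : sSup S ∈ U) :
    ∃ F : Finset L, (F : Set L) ⊆ S ∧ F.sup id ∈ U := by
  classical
  have hS : sSup S = sSup ((fun F : Finset L => F.sup id) '' {F | (F : Set L) ⊆ S}) := by
    refine le_antisymm (sSup_le fun x hx => le_sSup ⟨{x}, by simpa using hx, by simp⟩)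
      (sSup_le ?_)
    rintro _ ⟨F, hF, rfl⟩
    exact Finset.sup_le fun x hx => le_sSup (hF hx)
  rw [hS] at h
  obtain ⟨_, ⟨F, hF, rfl⟩, hFU⟩ := exists_mem_of_sSup_mem hU
    (Set.Nonempty.image _ ⟨∅, by simp⟩)
    (by
      rintro _ ⟨F, hF, rfl⟩ _ ⟨G, hG, rfl⟩
      refine ⟨_, ⟨F ∪ G, ?_, rfl⟩, Finset.sup_mono Finset.subset_union_left,
        Finset.sup_mono Finset.subset_union_right⟩
      rw [mem_ofPred_eq, Finset.coe_union]
      exact union_subset hF hG) h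
  exact ⟨F, hF, hFU⟩

theorem continuous_supBary (hc : Continuous fun p : L × L => p.1 ⊔ p.2) :
    Continuous (supBary (L := L)) := by
  have : ContinuousSup L := ⟨hc⟩
  refine continuous_def.2 fun U hU => isOpen_iff_mem_nhds.2 fun ν hν => ?_
  obtain ⟨F, hF, hFU⟩ := exists_finset_sup_mem hU hν
  have hcont : Continuous fun y : F → L => Finset.univ.sup y :=
    Continuous.finset_sup_apply fun i _ => continuous_apply i
  have hmem : (fun i : F => (i : L)) ∈ (fun y : F → L => Finset.univ.sup y) ⁻¹' U := by
    rwa [← Finset.sup_attach F id] at hFU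
  obtain ⟨V, hV, hVU⟩ := isOpen_pi_iff'.1 (hU.preimage hcont) _ hmem
  -- Each `V i` contains the support point `i` of `ν`, hence has positive measure; as `F` is finite,
  -- the conditions hold jointly on a neighbourhood.
  have hN : ∀ᶠ μ in nhds ν, ∀ i : F, 0 < μ (⟨V i, (hV i).1⟩ : Opens L) :=
    Filter.eventually_all.2 fun i => (isOpen_setOf_apply_pos _).mem_nhds
      ((ν.apply_pos_iff _).2 ⟨i, hF i.2, (hV i).2⟩)
  filter_upwards [hN] with μ hμ
  choose y hy hyV using fun i => (μ.apply_pos_iff _).1 (hμ i)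
  -- The join of the chosen support points `y i` of `μ` lies in `U` and below `supBary μ`.
  exact isUpperSet_of_isOpen hU (Finset.sup_le fun i _ => le_sSup (hy i))
    (hVU (mem_univ_pi.2 hyV))

end ScottLattice

end ValuationMonad

/-! ### The equivalences and their two complements. -/

theorem mainTheorem10 {L : Type*} [CompleteLattice L] [TopologicalSpace L]
    [Topology.IsScott L Set.univ] :
    List.TFAE
      [∃ α : ValuationMonad.ContValuation L → L,
          ValuationMonad.IsAlgebra α ∧ ValuationMonad.InducesLatticeCone α,
        ValuationMonad.IsAlgebra (ValuationMonad.supBary (L := L)),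
        Continuous (ValuationMonad.supBary (L := L)),
        Continuous (fun p : L × L => p.1 ⊔ p.2),
        ValuationMonad.WeaklyHausdorff L] ∧
      (ValuationMonad.CoreCompact L → ValuationMonad.WeaklyHausdorff L) ∧
      (ValuationMonad.WeaklyHausdorff L → ValuationMonad.Sober L) := by
  open ValuationMonad in
  refine ⟨?_, CoreCompact.weaklyHausdorff, WeaklyHausdorff.sober⟩
  tfae_have 1 → 4
  | ⟨_, hα, hcone⟩ => continuous_sup_of_inducesLatticeCone hα.cont hcone
  tfae_have 4 → 3 := continuous_supBary
  tfae_have 3 → 2 := isAlgebra_supBary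
  tfae_have 2 → 1 := fun h => ⟨_, h, inducesLatticeCone_supBary⟩
  tfae_have 4 ↔ 5 := continuous_sup_iff_weaklyHausdorff
  tfae_finish
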